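/- Let $a<b$ and let $\gamma_1,\gamma_2:[a,b]\to\mathbb R$ be continuous functions such that $1\in\operatorname{span}\{\gamma_1,\gamma_2\}$ on $[a,b]$ and $d(x,y)=\gamma_1(x)\gamma_2(y)-\gamma_1(y)\gamma_2(x)\neq 0$ for all distinct $x,y\in[a,b]$. Write $P(t)=(\gamma_1(t),\gamma_2(t))$. For a function $f$ on $[a,b]$ put $D f(x_0)=\lim_{x\to x_0,\ x\in[a,b]}\frac{f(x)-f(x_0)}{d(x_0,x)}$ when the limit exists; $f$ is called $r$ times $D$-differentiable, $r\in\{0,1,2,\dots\}\cup\{\infty\}$, if $D^jf$ exists on all of $[a,b]$ for every finite $j\le r$, and a function $F$ that is $p$ times $D$-differentiable with $D^pF=H$ on $[a,b]$ is called a $p$-th antiderivative of $H$ and denoted $D^{-p}H$. The non-polynomial divided difference $f[\varepsilon_1,\dots,\varepsilon_n]$, $n\ge1$, on possibly coinciding nodes in $[a,b]$ is defined by recursion on $n$: it is $D^{n-1}f(t)/(n-1)!$ if all nodes equal $t$; otherwise, if $y=\varepsilon_n$ is the last node and $z$ is the last node different from $y$, it is $\bigl(f[\text{all nodes but that } z]-f[\varepsilon_1,\dots,\varepsilon_{n-1}]\bigr)/d(z,y)$.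 For distinct nodes this is $f[\varepsilon_1,\dots,\varepsilon_n]=\bigl(f[\varepsilon_1,\dots,\varepsilon_{n-2},\varepsilon_n]-f[\varepsilon_1,\dots,\varepsilon_{n-1}]\bigr)/d(\varepsilon_{n-1},\varepsilon_n)$, $f[\varepsilon_1]=f(\varepsilon_1)$. Let $N\in\mathbb N\cup\{\infty\}$ and $k\in\mathbb Z$. Call a tuple $(u_1,v_1),\dots,(u_n,v_n)$ admissible if its members lie on the curve $P([a,b])$ and no value occurs more than $N$ times among them. An extended non-polynomial homogeneous blossom of order $k$ of $H$ (with at most $N$-fold $(u,v)$ parameters) is a family of functions $h((x_1,w_1),\dots,(x_m,w_m)/(u_1,v_1),\dots,(u_n,v_n))$, for all $m,n\ge 0$ with $m-n=k$, of arbitrary pairs $(x_i,w_i)\in\mathbb R^2$ and admissible $(u_j,v_j)$, that has the following properties whenever the $(u,v)$ parameters that occur are admissible: * bisymmetry: $h$ does not change when the $(x_i,w_i)$ are permuted and the $(u_j,v_j)$ are permuted; * multilinearity: $h$ is linear in each pair $(x_i,w_i)$; * cancellation: $h((x_1,w_1),\dots,(x_m,w_m),(y,z)/(u_1,v_1),\dots,(u_n,v_n),(y,z))=h((x_1,w_1),\dots,(x_m,w_m)/(u_1,v_1),\dots,(u_n,v_n))$;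 * diagonal: $h(P(t),\dots,P(t)/P(t),\dots,P(t))=H(t)$ for $t\in[a,b]$. **Theorem.** Let $H:[a,b]\to\mathbb R$ be continuous and $r$ times $D$-differentiable for some $r\in\{0,1,2,\dots\}\cup\{\infty\}$ (so $r=1$ if $H$ is just $D$-differentiable), let $k<0$ be an integer and $N=-k+r$. Then $H$ has $p$-th antiderivatives for $p=-k-1$, and there is an extended non-polynomial homogeneous blossom $h$ of order $k$ of $H$ with at most $N$-fold $(u,v)$ parameters such that for all $m,n$ with $m-n=k$, for every choice of the antiderivative $D^{-(n-m-1)}H$, all $(x_i,w_i)\in\mathbb R^2$ and all $\varepsilon_1,\dots,\varepsilon_n\in[a,b]$ none of which occurs more than $N$ times, $$h((x_1,w_1),\dots,(x_m,w_m)/(u_1,v_1),\dots,(u_n,v_n))=\Bigl\{(n-m-1)!\prod_{i=1}^m\bigl(x_i\gamma_2(x)-w_i\gamma_1(x)\bigr)\,D^{-(n-m-1)}H(x)\Bigr\}[\varepsilon_1,\dots,\varepsilon_n],$$ where $(u_i,v_i)=(\gamma_1(\varepsilon_i),\gamma_2(\varepsilon_i))$, $i=1,\dots,n$. In particular the right-hand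 side satisfies the four axioms and does not depend on the choice of the antiderivative. If $r=\infty$, or for given $m,n$ if $r\ge m$, there is no restriction on repetitions of the $\varepsilon_i$. -/

import Mathlib

open Set Filter Topology

noncomputable section

namespace NonpolyBlossom

/-- `d(x, y) = γ₁(x) γ₂(y) - γ₁(y) γ₂(x)`. -/
def dfun (γ₁ γ₂ : ℝ → ℝ) (x y : ℝ) : ℝ := γ₁ x * γ₂ y - γ₁ y * γ₂ x

/-- The function `f` on `[a, b]` has generalized derivative `c` at `x₀`:
`(f x - f x₀) / d(x₀, x) → c` as `x → x₀`, `x ∈ [a, b]`, `x ≠ x₀`. -/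
def HasGenDerivAt (γ₁ γ₂ : ℝ → ℝ) (a b : ℝ) (f : ℝ → ℝ) (c x₀ : ℝ) : Prop :=
  Tendsto (fun x => (f x - f x₀) / dfun γ₁ γ₂ x₀ x) (𝓝[Icc a b \ {x₀}] x₀) (𝓝 c)

/-- The generalized derivative `D_{γ₁,γ₂} f` on `[a, b]`; the `n`-th one is `(genDeriv γ₁ γ₂ a b)^[n] f`. -/
def genDeriv (γ₁ γ₂ : ℝ → ℝ) (a b : ℝ) (f : ℝ → ℝ) (x₀ : ℝ) : ℝ :=
  limUnder (𝓝[Icc a b \ {x₀}] x₀) (fun x => (f x - f x₀) / dfun γ₁ γ₂ x₀ x)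

/-- `f` is `r` times differentiable on `[a, b]` in the generalized sense (`r = ⊤`: infinitely often):
all generalized derivatives of finite order at most `r` exist on `[a, b]`. -/
def GenDifferentiable (γ₁ γ₂ : ℝ → ℝ) (a b : ℝ) (r : ℕ∞) (f : ℝ → ℝ) : Prop :=
  ∀ j : ℕ, (j : ℕ∞) < r → ∀ x ∈ Icc a b,
    ∃ c, HasGenDerivAt γ₁ γ₂ a b ((genDeriv γ₁ γ₂ a b)^[j] f) c x

/-- `F` is a `p`-th generalized antiderivative of `H` on `[a, b]`. -/
def IsGenAntideriv (γ₁ γ₂ : ℝ → ℝ) (a b : ℝ) (p : ℕ) (F H : ℝ → ℝ) : Prop :=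
  GenDifferentiable γ₁ γ₂ a b p F ∧ ∀ x ∈ Icc a b, (genDeriv γ₁ γ₂ a b)^[p] F x = H x

open Classical in
/-- The non-polynomial divided difference `f[ε₀, …, εₙ₋₁]` on `n ≥ 1` nodes (with the unused value `0`
for `n = 0`). The nodes may coincide. If all nodes are equal to `t`, it is `Dⁿ⁻¹ f(t) / (n - 1)!`.
Otherwise, let `y` be the last node and `z` the last node that differs from `y`; then it is
`(f[nodes without z] - f[nodes without the last node y]) / d(z, y)`. When the last two nodes
differ, in particular when all nodes are distinct, this is the recursion
`f[…, w, z, y] = (f[…, w, y] - f[…, w, z]) / d(z, y)`. -/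
def divDiff (γ₁ γ₂ : ℝ → ℝ) (a b : ℝ) (f : ℝ → ℝ) : (n : ℕ) → (Fin n → ℝ) → ℝ
  | 0, _ => 0
  | 1, ε => f (ε 0)
  | n + 2, ε =>
    if h : (Finset.univ.filter fun i => ε i ≠ ε (Fin.last (n + 1))).Nonempty then
      let i := (Finset.univ.filter fun i => ε i ≠ ε (Fin.last (n + 1))).max' h
      (divDiff γ₁ γ₂ a b f (n + 1) (fun j => ε (i.succAbove j)) -
          divDiff γ₁ γ₂ a b f (n + 1) (fun j => ε ((Fin.last (n + 1)).succAbove j))) /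
        dfun γ₁ γ₂ (ε i) (ε (Fin.last (n + 1)))
    else (genDeriv γ₁ γ₂ a b)^[n + 1] f (ε 0) / (Nat.factorial (n + 1) : ℝ)

/-- The planar curve `P(t) = (γ₁(t), γ₂(t))`. -/
def curve (γ₁ γ₂ : ℝ → ℝ) (t : ℝ) : ℝ × ℝ := (γ₁ t, γ₂ t)

/-- The `(u, v)` parameters lie on the curve `P([a, b])`, and no value occurs more than `N` times
among them (`N = ⊤`: no restriction on repetitions). -/
def Admissible (γ₁ γ₂ : ℝ → ℝ) (a b : ℝ) (N : ℕ∞) {n : ℕ} (U : Fin n → ℝ × ℝ) : Prop :=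
  (∀ j, U j ∈ curve γ₁ γ₂ '' Icc a b) ∧ ∀ Q : ℝ × ℝ, {j | U j = Q}.encard ≤ N

/-- `h` is an extended non-polynomial homogeneous blossom of order `k` of the function `H` on `[a, b]`.
It is a family of functions `h m n` of `m` pairs `(x, w)` and `n` pairs `(u, v)`, of which the members
with `m - n = k` matter, and the `(u, v)` range over the admissible tuples on the curve. -/
structure IsExtendedBlossom (γ₁ γ₂ : ℝ → ℝ) (a b : ℝ) (k : ℤ) (N : ℕ∞) (H : ℝ → ℝ)
    (h : (m n : ℕ) → (Fin m → ℝ × ℝ) → (Fin n → ℝ × ℝ) → ℝ) : Prop where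
  bisymmetry : ∀ m n : ℕ, (m : ℤ) - n = k → ∀ (X : Fin m → ℝ × ℝ) (U : Fin n → ℝ × ℝ),
    Admissible γ₁ γ₂ a b N U → ∀ (σ : Equiv.Perm (Fin m)) (τ : Equiv.Perm (Fin n)),
      h m n (X ∘ σ) (U ∘ τ) = h m n X U
  multilinearity : ∀ m n : ℕ, (m : ℤ) - n = k → ∀ (X : Fin m → ℝ × ℝ) (U : Fin n → ℝ × ℝ),
    Admissible γ₁ γ₂ a b N U → ∀ (i : Fin m) (α β : ℝ) (Y Z : ℝ × ℝ),
      h m n (Function.update X i (α • Y + β • Z)) U =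
        α * h m n (Function.update X i Y) U + β * h m n (Function.update X i Z) U
  cancellation : ∀ m n : ℕ, (m : ℤ) - n = k → ∀ (X : Fin m → ℝ × ℝ) (U : Fin n → ℝ × ℝ) (Y : ℝ × ℝ),
    Admissible γ₁ γ₂ a b N (Fin.snoc U Y : Fin (n + 1) → ℝ × ℝ) →
      h (m + 1) (n + 1) (Fin.snoc X Y) (Fin.snoc U Y) = h m n X U
  diagonal : ∀ m n : ℕ, (m : ℤ) - n = k → ∀ t ∈ Icc a b,
    Admissible γ₁ γ₂ a b N (fun _ : Fin n => curve γ₁ γ₂ t) →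
      h m n (fun _ => curve γ₁ γ₂ t) (fun _ => curve γ₁ γ₂ t) = H t

end NonpolyBlossom

end

/-! Let `c₁ γ₁ + c₂ γ₂ = 1` and complete `(c₁, c₂)` to a matrix of determinant one by a row `(e₁,
e₂)`. With `τ = e₁ γ₁ + e₂ γ₂` one has `d(x, y) = τ y - τ x`, and `γ₁`, `γ₂` are affine functions of
`τ` (`exists_param`). So `D` is differentiation with respect to `τ`, the divided differences are
classical ones in `τ`, and each factor `x γ₂ - w γ₁` is a polynomial `ℓ (x, w)` in `τ` of degree at
most one, equal to `X - τ(t)` when `(x, w) = P(t)`.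

A divided difference sees only the jets of the function at the nodes, so the antiderivative `F` may
be replaced by a Hermite interpolant `q` (`exists_jetEq`, `divDiff_eq_of_jetEq`). What remains is
`polyDivDiff`, a coefficient of the remainder modulo the node polynomial. It is visibly symmetric
and linear. Cancellation holds because a common factor `X - e` can be pulled out of a division with
remainder (`polyDivDiff_snoc`). On the diagonal all `m` linear factors cancel and the `p`-th Taylor
coefficient of `F` is left, with `p = -k - 1`; the factor `p!` turns it into `D^p F = H`.

Another antiderivative differs from `F` by a polynomial in `τ` of degree below `p`
(`exists_poly_of_genAntideriv`). Its product with `m` linear forms has degree below `p + m = n - 1`,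
so its divided difference vanishes (`polyDivDiff_prod_eq_zero`). The bound `N = p + 1 + r` enters
because a node of multiplicity `μ` uses `μ - 1 ≤ p + r` derivatives of `F`. -/

noncomputable section

namespace NonpolyBlossom

open Polynomial

/-! ### Divided differences and Hermite interpolation of polynomials -/

/-- The divided difference of a polynomial: the coefficient of degree `n - 1` of its Hermite
interpolant at the `n` nodes `s`. -/
def polyDivDiff (q : ℝ[X]) {n : ℕ} (s : Fin n → ℝ) : ℝ :=
  (q %ₘ ∏ i, (X - C (s i))).coeff (n - 1)

lemma monic_nodes {n : ℕ} (s : Fin n → ℝ) : (∏ i, (X - C (s i))).Monic :=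
  monic_prod_of_monic _ _ fun i _ => monic_X_sub_C (s i)

lemma natDegree_nodes {n : ℕ} (s : Fin n → ℝ) : (∏ i, (X - C (s i))).natDegree = n := by
  rw [natDegree_prod_of_monic _ _ fun i _ => monic_X_sub_C (s i)]
  simp

lemma degree_nodes {n : ℕ} (s : Fin n → ℝ) : (∏ i, (X - C (s i))).degree = (n : WithBot ℕ) := by
  rw [degree_eq_natDegree (monic_nodes s).ne_zero, natDegree_nodes]

lemma polyDivDiff_linear (α β : ℝ) (q₁ q₂ : ℝ[X]) {n : ℕ} (s : Fin n → ℝ) :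
    polyDivDiff (C α * q₁ + C β * q₂) s = α * polyDivDiff q₁ s + β * polyDivDiff q₂ s := by
  simp [polyDivDiff, add_modByMonic, ← smul_eq_C_mul, smul_modByMonic]

lemma polyDivDiff_perm (q : ℝ[X]) {n : ℕ} (s : Fin n → ℝ) (σ : Equiv.Perm (Fin n)) :
    polyDivDiff q (s ∘ σ) = polyDivDiff q s := by
  unfold polyDivDiff
  rw [← Equiv.prod_comp σ fun i => X - C (s i)]
  rfl

lemma polyDivDiff_eq_coeff {q : ℝ[X]} {n : ℕ} (s : Fin n → ℝ) (hq : q.degree < n) :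
    polyDivDiff q s = q.coeff (n - 1) := by
  unfold polyDivDiff
  rw [(modByMonic_eq_self_iff (monic_nodes s)).2 (by rwa [degree_nodes])]

/-- If `R` is the remainder of `q` modulo `W`, then `R (X - e)` is that of `q (X - e)` modulo `W (X
- e)`, with the same top coefficient. This is the source of the cancellation axiom. -/
lemma polyDivDiff_snoc (q : ℝ[X]) {n : ℕ} (hn : n ≠ 0) (s : Fin n → ℝ) (e : ℝ) :
    polyDivDiff (q * (X - C e)) (Fin.snoc s e : Fin (n + 1) → ℝ) = polyDivDiff q s := by
  obtain ⟨n, rfl⟩ := Nat.exists_eq_succ_of_ne_zero hn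
  unfold polyDivDiff
  rw [Fin.prod_univ_castSucc]
  simp only [Fin.snoc_castSucc, Fin.snoc_last]
  have hW := monic_nodes s
  rw [← (div_modByMonic_unique (f := q * (X - C e)) (g := (∏ i, (X - C (s i))) * (X - C e))
    (q /ₘ ∏ i, (X - C (s i))) ((q %ₘ ∏ i, (X - C (s i))) * (X - C e))
    (hW.mul (monic_X_sub_C e)) ⟨?_, ?_⟩).2.symm]
  · have h0 : (q %ₘ ∏ i, (X - C (s i))).coeff (n + 1) = 0 := by
      apply coeff_eq_zero_of_degree_lt
      have := degree_modByMonic_lt q hW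
      rwa [degree_nodes] at this
    simp [mul_sub, coeff_mul_X, h0]
  · conv_rhs => rw [← modByMonic_add_div q (∏ i, (X - C (s i)))]
    ring
  · rw [degree_mul, degree_mul, degree_X_sub_C]
    exact WithBot.add_lt_add_right (by simp) (degree_modByMonic_lt q hW)

/-- Let `R` be the remainder for all nodes and `V` the node polynomial without `s i`. Subtracting
from `R` its top coefficient times `V` lowers the degree enough to give the remainder modulo `V`. -/
lemma polyDivDiff_succAbove (q : ℝ[X]) {n : ℕ} (s : Fin (n + 2) → ℝ) (i : Fin (n + 2)) :
    polyDivDiff q (fun j => s (i.succAbove j)) =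
      (q %ₘ ∏ i, (X - C (s i))).coeff n -
        (q %ₘ ∏ i, (X - C (s i))).coeff (n + 1) * (∏ j, (X - C (s (i.succAbove j)))).coeff n := by
  set W := ∏ i, (X - C (s i)) with hWdef
  set V := ∏ j, (X - C (s (i.succAbove j))) with hVdef
  have hWV : W = (X - C (s i)) * V := Fin.prod_univ_succAbove _ i
  set R := q %ₘ W
  have hV : V.Monic := monic_nodes fun j => s (i.succAbove j)
  have hVd : V.natDegree = n + 1 := natDegree_nodes fun j => s (i.succAbove j)
  have hVdeg : V.degree = (n + 1 : ℕ) := degree_nodes fun j => s (i.succAbove j)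
  have hVc : V.coeff (n + 1) = 1 := by rw [← hVd]; exact hV
  have hR : R.degree < (n + 2 : ℕ) := by
    have := degree_modByMonic_lt q (monic_nodes s)
    rwa [degree_nodes] at this
  have key : q %ₘ V = R - C (R.coeff (n + 1)) * V := by
    refine (div_modByMonic_unique (f := q) (g := V)
      ((X - C (s i)) * (q /ₘ W) + C (R.coeff (n + 1))) _ hV ⟨?_, ?_⟩).2
    · conv_rhs => rw [← modByMonic_add_div q W]
      rw [hWV]
      simp only [R, hWV]
      ring
    · rw [hVdeg, degree_lt_iff_coeff_zero]
      intro m hm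
      rcases Nat.eq_or_lt_of_le hm with rfl | hm
      · simp [hVc]
      · rw [degree_lt_iff_coeff_zero] at hR
        have h1 := hR m hm
        have h2 : V.coeff m = 0 := coeff_eq_zero_of_natDegree_lt (by omega)
        simp [h1, h2]
  change (q %ₘ V).coeff n = _
  rw [key]
  simp

lemma polyDivDiff_recursion (q : ℝ[X]) {n : ℕ} (s : Fin (n + 2) → ℝ) (i l : Fin (n + 2)) :
    polyDivDiff q (fun j => s (i.succAbove j)) - polyDivDiff q (fun j => s (l.succAbove j)) =
      polyDivDiff q s * (s l - s i) := by
  -- The second-highest coefficient is minus the sum of the nodes, so omitting `s i` raises it by `s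
  -- i`. In the difference of the two divided differences only `s l - s i` survives.
  have h : ∀ i, (∏ j, (X - C (s (i.succAbove j)))).coeff n =
      (∏ i, (X - C (s i))).coeff (n + 1) + s i := by
    intro i
    have hV : (∏ j, (X - C (s (i.succAbove j)))).coeff (n + 1) = 1 := by
      have := monic_nodes fun j => s (i.succAbove j)
      rwa [Monic, leadingCoeff, natDegree_nodes fun j => s (i.succAbove j)] at this
    rw [Fin.prod_univ_succAbove (fun j => X - C (s j)) i, sub_mul, coeff_sub, coeff_X_mul,
      coeff_C_mul, hV]
    ring
  rw [polyDivDiff_succAbove, polyDivDiff_succAbove, h, h]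
  simp only [polyDivDiff, show n + 2 - 1 = n + 1 from rfl]
  ring

/-- The remainder modulo `(X - t)^(n+1)` has the same `n`-th derivative at `t` as `q`, and that
derivative is a constant, `n!` times the top coefficient. -/
lemma polyDivDiff_const (q : ℝ[X]) (n : ℕ) (t : ℝ) :
    polyDivDiff q (fun _ : Fin (n + 1) => t) = (derivative^[n] q).eval t / n.factorial := by
  have hn : (n.factorial : ℝ) ≠ 0 := by positivity
  rw [eq_div_iff hn]
  unfold polyDivDiff
  have hd := degree_modByMonic_lt q (monic_nodes fun _ : Fin (n + 1) => t)
  rw [degree_nodes] at hd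
  have hdec := modByMonic_add_div q (∏ _i : Fin (n + 1), (X - C t))
  set R := q %ₘ ∏ _i : Fin (n + 1), (X - C t)
  set Q := q /ₘ ∏ _i : Fin (n + 1), (X - C t)
  rw [← hdec, iterate_map_add, eval_add]
  have h1 : (derivative^[n] ((∏ _i : Fin (n + 1), (X - C t)) * Q)).eval t = 0 := by
    rw [Finset.prod_const, Finset.card_univ, Fintype.card_fin]
    have hdvd : (X - C t) ^ (n + 1 - n) ∣ derivative^[n] ((X - C t) ^ (n + 1) * Q) :=
      pow_sub_dvd_iterate_derivative_of_pow_dvd n (Dvd.intro _ rfl)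
    rw [Nat.add_sub_cancel_left, pow_one] at hdvd
    exact dvd_iff_isRoot.1 hdvd
  have h2 : derivative^[n] R = C (R.coeff n * n.factorial) := by
    ext j
    rw [coeff_iterate_derivative, coeff_C]
    split_ifs with hj
    · subst hj
      simp [Nat.descFactorial_self, mul_comm]
    · rw [degree_lt_iff_coeff_zero] at hd
      rw [hd (j + n) (by omega), smul_zero]
  rw [h1, h2]
  simp

/-- Hermite interpolation: the derivatives of a polynomial can be prescribed at finitely many nodes. -/
lemma exists_hermite (y : ℝ → ℕ → ℝ) (S : Multiset ℝ) :
    ∃ q : ℝ[X], ∀ t, ∀ j < S.count t, (derivative^[j] q).eval t = y t j := by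
  induction S using Multiset.induction with
  | empty => exact ⟨0, by simp⟩
  | cons e S ih =>
    obtain ⟨q, hq⟩ := ih
    set W : ℝ[X] := (S.map fun a => X - C a).prod with hW
    have hW0 : W ≠ 0 := (monic_multiset_prod_of_monic _ _ fun a _ => monic_X_sub_C a).ne_zero
    have hmult : ∀ t, W.rootMultiplicity t = S.count t := by
      intro t
      rw [← count_roots, hW, roots_multiset_prod_X_sub_C]
    have hne : (derivative^[S.count e] W).eval e ≠ 0 := by
      rw [← hmult, eval_iterate_derivative_rootMultiplicity]
      rw [nsmul_eq_mul]
      exact mul_ne_zero (by positivity) (eval_divByMonic_pow_rootMultiplicity_ne_zero e hW0)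
    have hz : ∀ t, ∀ j < S.count t, (derivative^[j] W).eval t = 0 := by
      intro t j hj
      exact isRoot_iterate_derivative_of_lt_rootMultiplicity (by rwa [hmult])
    -- Newton step: `W` vanishes at each old node exactly to its multiplicity, so adding a multiple
    -- of it keeps the old data, and the scalar fixes the one new derivative at `e`.
    refine ⟨q + C ((y e (S.count e) - (derivative^[S.count e] q).eval e) /
      (derivative^[S.count e] W).eval e) * W, fun t j hj => ?_⟩
    rw [iterate_map_add, iterate_derivative_C_mul, eval_add, eval_mul, eval_C]
    by_cases hjt : j < S.count t
    · rw [hz t j hjt, hq t j hjt]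
      ring
    · rw [Multiset.count_cons] at hj
      split_ifs at hj with het
      · subst het
        obtain rfl : j = S.count t := by omega
        field_simp
        ring
      · omega

/-! ### Generalized derivatives as derivatives in the parameter `τ` -/

variable {γ₁ γ₂ : ℝ → ℝ} {a b : ℝ} {τ : ℝ → ℝ}

/-- `τ` is a parameter on `[a, b]` for which the generalized derivative is the derivative with
respect to `τ`. -/
structure IsParam (γ₁ γ₂ : ℝ → ℝ) (a b : ℝ) (τ : ℝ → ℝ) : Prop where
  lt : a < b
  cont : ContinuousOn τ (Icc a b)
  inj : InjOn τ (Icc a b)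
  dfun_eq : ∀ x ∈ Icc a b, ∀ y ∈ Icc a b, dfun γ₁ γ₂ x y = τ y - τ x

namespace IsParam

/-- A continuous injection of the compact interval is an embedding, so limits along `[a, b]` and
along its image correspond. -/
lemma map_nhdsWithin (hτ : IsParam γ₁ γ₂ a b τ) {x : ℝ} (hx : x ∈ Icc a b) :
    map τ (𝓝[Icc a b] x) = 𝓝[τ '' Icc a b] (τ x) := by
  have he : IsClosedEmbedding ((Icc a b).domRestrict τ) :=
    hτ.cont.domRestrict.isClosedEmbedding (injOn_iff_injective.1 hτ.inj)
  have := he.isEmbedding.map_nhds_eq ⟨x, hx⟩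
  rw [range_domRestrict] at this
  rw [nhdsWithin_eq_map_subtype_coe hx, map_map]
  exact this

lemma map_nhdsWithin_diff (hτ : IsParam γ₁ γ₂ a b τ) {x : ℝ} (hx : x ∈ Icc a b) :
    map τ (𝓝[Icc a b \ {x}] x) = 𝓝[τ '' Icc a b \ {τ x}] (τ x) := by
  have h : Icc a b \ {x} = Icc a b ∩ τ ⁻¹' {τ x}ᶜ := by
    ext y
    simp only [Set.mem_sdiff, mem_singleton_iff, mem_inter_iff, mem_preimage, mem_compl_iff]
    exact and_congr_right fun hy => not_congr (hτ.inj.eq_iff hy hx).symm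
  rw [h, nhdsWithin_inter', map_inf_principal_preimage, hτ.map_nhdsWithin hx, Set.sdiff_eq,
    nhdsWithin_inter']

lemma neBot (hτ : IsParam γ₁ γ₂ a b τ) {x : ℝ} (hx : x ∈ Icc a b) :
    NeBot (𝓝[Icc a b \ {x}] x) := by
  have := (uniqueDiffOn_Icc hτ.lt x hx).accPt
  rwa [accPt_principal_iff_nhdsWithin] at this

lemma hasGenDerivAt_iff (hτ : IsParam γ₁ γ₂ a b τ) {f : ℝ → ℝ} {c x : ℝ} (hx : x ∈ Icc a b) :
    HasGenDerivAt γ₁ γ₂ a b f c x ↔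
      HasDerivWithinAt (f ∘ Function.invFunOn τ (Icc a b)) c (τ '' Icc a b) (τ x) := by
  rw [hasDerivWithinAt_iff_tendsto_slope, ← hτ.map_nhdsWithin_diff hx, tendsto_map'_iff]
  refine tendsto_congr' ?_
  filter_upwards [self_mem_nhdsWithin] with y hy
  simp only [Function.comp, slope_def_field]
  rw [hτ.inj.leftInvOn_invFunOn hx, hτ.inj.leftInvOn_invFunOn hy.1, hτ.dfun_eq x hx y hy.1]

lemma comp_hasGenDerivAt (hτ : IsParam γ₁ γ₂ a b τ) {g : ℝ → ℝ} {c x : ℝ} (hx : x ∈ Icc a b)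
    (hg : HasDerivAt g c (τ x)) : HasGenDerivAt γ₁ γ₂ a b (g ∘ τ) c x := by
  rw [hτ.hasGenDerivAt_iff hx]
  have hs : ∀ s ∈ τ '' Icc a b, ((g ∘ τ) ∘ Function.invFunOn τ (Icc a b)) s = g s :=
    fun s hs => congrArg g (Function.invFunOn_eq hs)
  exact hg.hasDerivWithinAt.congr hs (hs _ (mem_image_of_mem _ hx))

end IsParam

lemma HasGenDerivAt.congr {f g : ℝ → ℝ} {c x : ℝ} (hx : x ∈ Icc a b)
    (hf : HasGenDerivAt γ₁ γ₂ a b f c x) (h : EqOn g f (Icc a b)) :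
    HasGenDerivAt γ₁ γ₂ a b g c x := by
  refine Tendsto.congr' ?_ hf
  filter_upwards [self_mem_nhdsWithin] with y hy
  rw [h hx, h hy.1]

lemma genDeriv_congr {f g : ℝ → ℝ} (h : EqOn f g (Icc a b)) :
    EqOn (genDeriv γ₁ γ₂ a b f) (genDeriv γ₁ γ₂ a b g) (Icc a b) := by
  intro x hx
  unfold genDeriv limUnder
  congr 1
  refine Filter.map_congr ?_
  filter_upwards [self_mem_nhdsWithin] with y hy
  rw [h hx, h hy.1]

lemma genDeriv_iterate_congr {f g : ℝ → ℝ} (h : EqOn f g (Icc a b)) (n : ℕ) :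
    EqOn ((genDeriv γ₁ γ₂ a b)^[n] f) ((genDeriv γ₁ γ₂ a b)^[n] g) (Icc a b) := by
  induction n with
  | zero => exact h
  | succ n ih =>
    rw [Function.iterate_succ_apply', Function.iterate_succ_apply']
    exact genDeriv_congr ih

lemma HasGenDerivAt.genDeriv_eq (hτ : IsParam γ₁ γ₂ a b τ) {f : ℝ → ℝ} {c x : ℝ}
    (hx : x ∈ Icc a b) (hf : HasGenDerivAt γ₁ γ₂ a b f c x) : genDeriv γ₁ γ₂ a b f x = c :=
  haveI := hτ.neBot hx
  hf.limUnder_eq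

lemma HasGenDerivAt.add {f g : ℝ → ℝ} {c c' x : ℝ} (hf : HasGenDerivAt γ₁ γ₂ a b f c x)
    (hg : HasGenDerivAt γ₁ γ₂ a b g c' x) : HasGenDerivAt γ₁ γ₂ a b (f + g) (c + c') x := by
  refine (Tendsto.add hf hg).congr fun y => ?_
  simp only [Pi.add_apply]
  ring

/-- Multiplication by a polynomial in the parameter `τ`. -/
def polyMul (τ : ℝ → ℝ) (u : ℝ[X]) (f : ℝ → ℝ) : ℝ → ℝ := fun x => u.eval (τ x) * f x

lemma HasGenDerivAt.polyMul (hτ : IsParam γ₁ γ₂ a b τ) (u : ℝ[X]) {f : ℝ → ℝ} {c x : ℝ}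
    (hx : x ∈ Icc a b) (hf : HasGenDerivAt γ₁ γ₂ a b f c x) :
    HasGenDerivAt γ₁ γ₂ a b (polyMul τ u f) (u.derivative.eval (τ x) * f x + u.eval (τ x) * c) x := by
  rw [hτ.hasGenDerivAt_iff hx] at hf ⊢
  have h := ((u.hasDerivAt (τ x)).hasDerivWithinAt (s := τ '' Icc a b)).mul hf
  have hs : ∀ s ∈ τ '' Icc a b, (NonpolyBlossom.polyMul τ u f ∘ Function.invFunOn τ (Icc a b)) s =
      u.eval s * (f ∘ Function.invFunOn τ (Icc a b)) s := fun s hs => by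
    simp only [Function.comp, NonpolyBlossom.polyMul]
    rw [Function.invFunOn_eq hs]
  refine (h.congr hs (hs _ (mem_image_of_mem _ hx))).congr_deriv ?_
  simp [hτ.inj.leftInvOn_invFunOn hx]

/-- The generalized derivative exists on all of `[a, b]`. -/
def GenDiffOn (γ₁ γ₂ : ℝ → ℝ) (a b : ℝ) (f : ℝ → ℝ) : Prop :=
  ∀ x ∈ Icc a b, ∃ c, HasGenDerivAt γ₁ γ₂ a b f c x

lemma GenDiffOn.hasGenDerivAt (hτ : IsParam γ₁ γ₂ a b τ) {f : ℝ → ℝ}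
    (hf : GenDiffOn γ₁ γ₂ a b f) {x : ℝ} (hx : x ∈ Icc a b) :
    HasGenDerivAt γ₁ γ₂ a b f (genDeriv γ₁ γ₂ a b f x) x := by
  obtain ⟨c, hc⟩ := hf x hx
  rwa [hc.genDeriv_eq hτ hx]

/-! ### Iterated generalized derivatives -/

lemma GenDifferentiable.mono {r r' : ℕ∞} (h : r' ≤ r) {f : ℝ → ℝ}
    (hf : GenDifferentiable γ₁ γ₂ a b r f) : GenDifferentiable γ₁ γ₂ a b r' f :=
  fun j hj => hf j (hj.trans_le h)

lemma genDifferentiable_zero (f : ℝ → ℝ) : GenDifferentiable γ₁ γ₂ a b (0 : ℕ) f :=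
  fun j hj => by simp at hj

lemma genDifferentiable_add_iff (f : ℝ → ℝ) (p n : ℕ) :
    GenDifferentiable γ₁ γ₂ a b (p + n : ℕ) f ↔
      GenDifferentiable γ₁ γ₂ a b p f ∧
        GenDifferentiable γ₁ γ₂ a b n ((genDeriv γ₁ γ₂ a b)^[p] f) := by
  constructor
  · refine fun h => ⟨h.mono (by exact_mod_cast Nat.le_add_right p n), fun j hj => ?_⟩
    rw [← Function.iterate_add_apply]
    exact h _ (by norm_cast at hj ⊢; omega)
  · rintro ⟨h₁, h₂⟩ j hj
    rcases lt_or_ge j p with hjp | hjp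
    · exact h₁ j (by exact_mod_cast hjp)
    · obtain ⟨i, rfl⟩ := Nat.exists_eq_add_of_le' hjp
      rw [Function.iterate_add_apply]
      exact h₂ i (by norm_cast at hj ⊢; omega)

lemma genDifferentiable_succ_iff (f : ℝ → ℝ) (n : ℕ) :
    GenDifferentiable γ₁ γ₂ a b (n + 1 : ℕ) f ↔
      GenDiffOn γ₁ γ₂ a b f ∧ GenDifferentiable γ₁ γ₂ a b n (genDeriv γ₁ γ₂ a b f) := by
  rw [add_comm, genDifferentiable_add_iff]
  refine and_congr_left fun _ => ⟨fun h => h 0 (by norm_num), fun h j hj => ?_⟩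
  obtain rfl : j = 0 := by norm_cast at hj; omega
  exact h

lemma GenDifferentiable.congr {r : ℕ∞} {f g : ℝ → ℝ} (hf : GenDifferentiable γ₁ γ₂ a b r f)
    (h : EqOn g f (Icc a b)) : GenDifferentiable γ₁ γ₂ a b r g := fun j hj x hx =>
  (hf j hj x hx).imp fun _ hc => hc.congr hx (genDeriv_iterate_congr h j)

lemma genDeriv_add (hτ : IsParam γ₁ γ₂ a b τ) {f g : ℝ → ℝ} (hf : GenDiffOn γ₁ γ₂ a b f)
    (hg : GenDiffOn γ₁ γ₂ a b g) : EqOn (genDeriv γ₁ γ₂ a b (f + g))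
      (genDeriv γ₁ γ₂ a b f + genDeriv γ₁ γ₂ a b g) (Icc a b) := fun _ hx =>
  ((hf.hasGenDerivAt hτ hx).add (hg.hasGenDerivAt hτ hx)).genDeriv_eq hτ hx

lemma GenDifferentiable.add (hτ : IsParam γ₁ γ₂ a b τ) {n : ℕ} {f g : ℝ → ℝ}
    (hf : GenDifferentiable γ₁ γ₂ a b n f) (hg : GenDifferentiable γ₁ γ₂ a b n g) :
    GenDifferentiable γ₁ γ₂ a b n (f + g) := by
  induction n generalizing f g with
  | zero => exact genDifferentiable_zero _
  | succ n ih =>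
    rw [genDifferentiable_succ_iff] at hf hg ⊢
    exact ⟨fun x hx => ⟨_, (hf.1.hasGenDerivAt hτ hx).add (hg.1.hasGenDerivAt hτ hx)⟩,
      (ih hf.2 hg.2).congr (genDeriv_add hτ hf.1 hg.1)⟩

lemma genDeriv_polyMul (hτ : IsParam γ₁ γ₂ a b τ) (u : ℝ[X]) {f : ℝ → ℝ}
    (hf : GenDiffOn γ₁ γ₂ a b f) : EqOn (genDeriv γ₁ γ₂ a b (polyMul τ u f))
      (polyMul τ u.derivative f + polyMul τ u (genDeriv γ₁ γ₂ a b f)) (Icc a b) := fun _ hx =>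
  ((hf.hasGenDerivAt hτ hx).polyMul hτ u hx).genDeriv_eq hτ hx

lemma GenDifferentiable.polyMul (hτ : IsParam γ₁ γ₂ a b τ) (u : ℝ[X]) {n : ℕ} {f : ℝ → ℝ}
    (hf : GenDifferentiable γ₁ γ₂ a b n f) :
    GenDifferentiable γ₁ γ₂ a b n (polyMul τ u f) := by
  induction n generalizing f u with
  | zero => exact genDifferentiable_zero _
  | succ n ih =>
    have hf' := hf.mono (r' := n) (by norm_cast; omega)
    rw [genDifferentiable_succ_iff] at hf ⊢
    exact ⟨fun x hx => ⟨_, (hf.1.hasGenDerivAt hτ hx).polyMul hτ u hx⟩,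
      ((ih _ hf').add hτ (ih u hf.2)).congr (genDeriv_polyMul hτ u hf.1)⟩

/-! ### Jets and the reduction of divided differences to polynomials -/

/-- At `t` the function `f` and its first `m - 1` generalized derivatives agree with those of the
polynomial `q` in `τ`. -/
def JetEq (γ₁ γ₂ : ℝ → ℝ) (a b : ℝ) (τ : ℝ → ℝ) (f : ℝ → ℝ) (q : ℝ[X]) (t : ℝ) (m : ℕ) : Prop :=
  ∀ j < m, (genDeriv γ₁ γ₂ a b)^[j] f t = (derivative^[j] q).eval (τ t)

lemma JetEq.mono {f : ℝ → ℝ} {q : ℝ[X]} {t : ℝ} {m m' : ℕ} (h : m' ≤ m)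
    (hf : JetEq γ₁ γ₂ a b τ f q t m) : JetEq γ₁ γ₂ a b τ f q t m' :=
  fun j hj => hf j (hj.trans_le h)

lemma JetEq.congr {f g : ℝ → ℝ} {q : ℝ[X]} {t : ℝ} {m : ℕ} (ht : t ∈ Icc a b)
    (hf : JetEq γ₁ γ₂ a b τ f q t m) (h : EqOn g f (Icc a b)) : JetEq γ₁ γ₂ a b τ g q t m :=
  fun j hj => (genDeriv_iterate_congr h j ht).trans (hf j hj)

lemma jetEq_succ_iff {f : ℝ → ℝ} {q : ℝ[X]} {t : ℝ} {m : ℕ} :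
    JetEq γ₁ γ₂ a b τ f q t (m + 1) ↔
      f t = q.eval (τ t) ∧ JetEq γ₁ γ₂ a b τ (genDeriv γ₁ γ₂ a b f) (derivative q) t m := by
  constructor
  · exact fun h => ⟨h 0 (by omega), fun j hj => h (j + 1) (by omega)⟩
  · rintro ⟨h₀, h₁⟩ (_ | j) hj
    · exact h₀
    · exact h₁ j (by omega)

lemma genDeriv_iterate_add (hτ : IsParam γ₁ γ₂ a b τ) {n : ℕ} {f g : ℝ → ℝ}
    (hf : GenDifferentiable γ₁ γ₂ a b n f) (hg : GenDifferentiable γ₁ γ₂ a b n g) :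
    EqOn ((genDeriv γ₁ γ₂ a b)^[n] (f + g))
      ((genDeriv γ₁ γ₂ a b)^[n] f + (genDeriv γ₁ γ₂ a b)^[n] g) (Icc a b) := by
  induction n generalizing f g with
  | zero => exact fun _ _ => rfl
  | succ n ih =>
    rw [genDifferentiable_succ_iff] at hf hg
    exact (genDeriv_iterate_congr (genDeriv_add hτ hf.1 hg.1) n).trans (ih hf.2 hg.2)

lemma JetEq.add (hτ : IsParam γ₁ γ₂ a b τ) {f g : ℝ → ℝ} {q q' : ℝ[X]} {t : ℝ} {m : ℕ}
    (ht : t ∈ Icc a b) (hf : JetEq γ₁ γ₂ a b τ f q t m) (hg : JetEq γ₁ γ₂ a b τ g q' t m)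
    (hfd : GenDifferentiable γ₁ γ₂ a b (m - 1 : ℕ) f)
    (hgd : GenDifferentiable γ₁ γ₂ a b (m - 1 : ℕ) g) :
    JetEq γ₁ γ₂ a b τ (f + g) (q + q') t m := by
  intro j hj
  have hjm : (j : ℕ∞) ≤ (m - 1 : ℕ) := by norm_cast; omega
  rw [genDeriv_iterate_add hτ (hfd.mono hjm) (hgd.mono hjm) ht, Pi.add_apply, hf j hj, hg j hj,
    iterate_map_add, eval_add]

/-- Leibniz rule on both sides. This is where differentiability of `f` is needed: `JetEq` alone only
compares values of `genDeriv`, which are defined even where the limit does not exist. -/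
lemma JetEq.polyMul (hτ : IsParam γ₁ γ₂ a b τ) (u : ℝ[X]) {f : ℝ → ℝ} {q : ℝ[X]} {t : ℝ} {m : ℕ}
    (ht : t ∈ Icc a b) (hf : JetEq γ₁ γ₂ a b τ f q t m)
    (hfd : GenDifferentiable γ₁ γ₂ a b (m - 1 : ℕ) f) :
    JetEq γ₁ γ₂ a b τ (polyMul τ u f) (u * q) t m := by
  induction m generalizing f q u with
  | zero => exact fun j hj => by omega
  | succ m ih =>
    have hf' := hf.mono (Nat.le_succ m)
    rw [jetEq_succ_iff] at hf ⊢
    refine ⟨by simp [NonpolyBlossom.polyMul, hf.1], ?_⟩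
    rcases m with _ | m
    · exact fun j hj => by omega
    have hfd' := hfd.mono (r' := m) (by norm_cast; omega)
    rw [Nat.add_sub_cancel, genDifferentiable_succ_iff] at hfd
    rw [derivative_mul]
    exact ((ih _ hf' hfd').add hτ ht (ih u hf.2 hfd.2) (hfd'.polyMul hτ _)
      (hfd.2.polyMul hτ _)).congr ht (genDeriv_polyMul hτ u hfd.1)

/-- The number of nodes equal to `t`. -/
def mult {n : ℕ} (ε : Fin n → ℝ) (t : ℝ) : ℕ := (Finset.univ.filter fun i => ε i = t).card

lemma mult_comp_le {n m : ℕ} (ε : Fin n → ℝ) {e : Fin m → Fin n} (he : Function.Injective e)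
    (t : ℝ) : mult (fun j => ε (e j)) t ≤ mult ε t := by
  refine Finset.card_le_card_of_injOn e (fun j hj => ?_) he.injOn
  simpa using hj

/-- Both sides obey the same recursion, since `polyDivDiff_recursion` allows any two nodes to be
omitted; coinciding nodes are settled by `polyDivDiff_const`. -/
lemma divDiff_eq_polyDivDiff (hτ : IsParam γ₁ γ₂ a b τ) {f : ℝ → ℝ} {q : ℝ[X]} {n : ℕ}
    {ε : Fin n → ℝ} (hε : ∀ i, ε i ∈ Icc a b)
    (hf : ∀ i, JetEq γ₁ γ₂ a b τ f q (ε i) (mult ε (ε i))) :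
    divDiff γ₁ γ₂ a b f n ε = polyDivDiff q (fun i => τ (ε i)) := by
  induction n with
  | zero => simp [divDiff, polyDivDiff]
  | succ n ih =>
    rcases n with _ | n
    · have h0 : (fun i => τ (ε i)) = fun _ : Fin (0 + 1) => τ (ε 0) := by
        funext i
        rw [Fin.fin_one_eq_zero i]
      rw [h0, polyDivDiff_const]
      have := hf 0 0 (by simp [mult, Finset.card_pos, Finset.filter_nonempty_iff])
      simpa [divDiff] using this
    · have hsub : ∀ i : Fin (n + 2), divDiff γ₁ γ₂ a b f (n + 1) (fun j => ε (i.succAbove j)) =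
          polyDivDiff q (fun j => τ (ε (i.succAbove j))) := fun i =>
        ih (fun j => hε _) fun j => (hf _).mono (mult_comp_le ε (Fin.succAbove_right_injective) _)
      rw [divDiff]
      split_ifs with h
      · have hi := Finset.max'_mem _ h
        simp only [Finset.mem_filter, Finset.mem_univ, true_and] at hi
        simp only [hsub]
        rw [hτ.dfun_eq _ (hε _) _ (hε _)]
        generalize Finset.max' _ h = i at hi ⊢
        have hne : τ (ε (Fin.last (n + 1))) - τ (ε i) ≠ 0 :=
          sub_ne_zero.2 fun h => hi (hτ.inj (hε _) (hε _) h).symm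
        rw [div_eq_iff hne]
        exact polyDivDiff_recursion q (fun j => τ (ε j)) i (Fin.last (n + 1))
      · simp only [Finset.filter_nonempty_iff, Finset.mem_univ, true_and, not_exists,
          not_not] at h
        have hall : ∀ i, ε i = ε 0 := fun i => (h i).trans (h 0).symm
        have h0 : (fun i => τ (ε i)) = fun _ : Fin (n + 1 + 1) => τ (ε 0) := by
          funext i
          rw [hall]
        rw [h0, polyDivDiff_const, hf 0 (n + 1) (by simp [mult, hall])]

lemma polyFun_hasGenDerivAt (hτ : IsParam γ₁ γ₂ a b τ) (e : ℝ[X]) {x : ℝ} (hx : x ∈ Icc a b) :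
    HasGenDerivAt γ₁ γ₂ a b (fun y => e.eval (τ y)) (e.derivative.eval (τ x)) x :=
  hτ.comp_hasGenDerivAt hx (e.hasDerivAt (τ x))

lemma polyFun_genDifferentiable (hτ : IsParam γ₁ γ₂ a b τ) (e : ℝ[X]) (n : ℕ) :
    GenDifferentiable γ₁ γ₂ a b n (fun y => e.eval (τ y)) := by
  induction n generalizing e with
  | zero => exact genDifferentiable_zero _
  | succ n ih =>
    rw [genDifferentiable_succ_iff]
    exact ⟨fun x hx => ⟨_, polyFun_hasGenDerivAt hτ e hx⟩, (ih e.derivative).congr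
      fun x hx => (polyFun_hasGenDerivAt hτ e hx).genDeriv_eq hτ hx⟩

lemma polyFun_jetEq (hτ : IsParam γ₁ γ₂ a b τ) (e : ℝ[X]) {t : ℝ} (ht : t ∈ Icc a b) (m : ℕ) :
    JetEq γ₁ γ₂ a b τ (fun y => e.eval (τ y)) e t m := by
  induction m generalizing e with
  | zero => exact fun j hj => by omega
  | succ m ih =>
    rw [jetEq_succ_iff]
    exact ⟨rfl, (ih e.derivative).congr ht
      fun x hx => (polyFun_hasGenDerivAt hτ e hx).genDeriv_eq hτ hx⟩

/-! ### Antiderivatives -/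

lemma exists_primitive (hτ : IsParam γ₁ γ₂ a b τ) {H : ℝ → ℝ} (hH : ContinuousOn H (Icc a b)) :
    ∃ F, ∀ x ∈ Icc a b, HasGenDerivAt γ₁ γ₂ a b F (H x) x := by
  have hJ : ContinuousOn (H ∘ Function.invFunOn τ (Icc a b)) (τ '' Icc a b) := by
    rintro _ ⟨x, hx, rfl⟩
    rw [ContinuousWithinAt, ← hτ.map_nhdsWithin hx, tendsto_map'_iff, Function.comp_apply,
      hτ.inj.leftInvOn_invFunOn hx]
    refine (hH x hx).congr' ?_
    filter_upwards [self_mem_nhdsWithin] with y hy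
    simp only [Function.comp_apply]
    rw [hτ.inj.leftInvOn_invFunOn hy]
  have himg := hτ.cont.image_Icc hτ.lt.le
  have hle : sInf (τ '' Icc a b) ≤ sSup (τ '' Icc a b) := by
    have := (nonempty_Icc.2 hτ.lt.le).image τ
    rw [himg] at this
    exact nonempty_Icc.1 this
  rw [himg] at hJ
  have hcont := hJ.domRestrict.Icc_extend' (h := hle)
  -- Integrate in `τ`. Extending the integrand by constants beyond the image interval makes it
  -- continuous on the line, so the base point `0` need not lie in the image.
  refine ⟨(fun s => ∫ y in (0 : ℝ)..s, IccExtend hle (domRestrict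
    (Icc (sInf (τ '' Icc a b)) (sSup (τ '' Icc a b)))
    (H ∘ Function.invFunOn τ (Icc a b))) y) ∘ τ, fun x hx => ?_⟩
  have h := hτ.comp_hasGenDerivAt hx (hcont.integral_hasStrictDerivAt 0 (τ x)).hasDerivAt
  have hval := IccExtend_of_mem hle
    (domRestrict (Icc (sInf (τ '' Icc a b)) (sSup (τ '' Icc a b)))
      (H ∘ Function.invFunOn τ (Icc a b)))
    (x := τ x) (himg ▸ mem_image_of_mem τ hx)
  rw [hval, domRestrict_apply, Function.comp_apply, hτ.inj.leftInvOn_invFunOn hx] at h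
  exact h

lemma HasGenDerivAt.continuousWithinAt (hτ : IsParam γ₁ γ₂ a b τ) {f : ℝ → ℝ} {c x : ℝ}
    (hx : x ∈ Icc a b) (hf : HasGenDerivAt γ₁ γ₂ a b f c x) :
    ContinuousWithinAt f (Icc a b) x := by
  have h := ((hτ.hasGenDerivAt_iff hx).1 hf).continuousWithinAt
  rw [ContinuousWithinAt, ← hτ.map_nhdsWithin hx, tendsto_map'_iff, Function.comp_apply,
      hτ.inj.leftInvOn_invFunOn hx] at h
  refine h.congr' ?_
  filter_upwards [self_mem_nhdsWithin] with y hy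
  simp only [Function.comp_apply]
  rw [hτ.inj.leftInvOn_invFunOn hy]

lemma exists_genAntideriv (hτ : IsParam γ₁ γ₂ a b τ) {H : ℝ → ℝ}
    (hH : ContinuousOn H (Icc a b)) (p : ℕ) :
    ∃ F, ContinuousOn F (Icc a b) ∧ IsGenAntideriv γ₁ γ₂ a b p F H := by
  induction p with
  | zero => exact ⟨H, hH, genDifferentiable_zero H, fun _ _ => rfl⟩
  | succ p ih =>
    obtain ⟨F, hFc, hFd, hF⟩ := ih
    obtain ⟨G, hG⟩ := exists_primitive hτ hFc
    have hDG : EqOn (genDeriv γ₁ γ₂ a b G) F (Icc a b) := fun x hx => (hG x hx).genDeriv_eq hτ hx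
    refine ⟨G, fun x hx => (hG x hx).continuousWithinAt hτ hx, ?_, fun x hx => ?_⟩
    · rw [genDifferentiable_succ_iff]
      exact ⟨fun x hx => ⟨_, hG x hx⟩, hFd.congr hDG⟩
    · rw [Function.iterate_succ_apply, genDeriv_iterate_congr hDG p hx, hF x hx]

lemma eq_of_hasGenDerivAt_zero (hτ : IsParam γ₁ γ₂ a b τ) {f : ℝ → ℝ}
    (hf : ∀ x ∈ Icc a b, HasGenDerivAt γ₁ γ₂ a b f 0 x) {x y : ℝ} (hx : x ∈ Icc a b)
    (hy : y ∈ Icc a b) : f y = f x := by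
  have hconv : Convex ℝ (τ '' Icc a b) := by
    rw [hτ.cont.image_Icc hτ.lt.le]
    exact convex_Icc _ _
  have h := hconv.norm_image_sub_le_of_norm_hasDerivWithin_le
    (f := f ∘ Function.invFunOn τ (Icc a b)) (f' := fun _ => 0) (C := 0)
    (by rintro _ ⟨z, hz, rfl⟩; exact (hτ.hasGenDerivAt_iff hz).1 (hf z hz)) (by simp)
    (mem_image_of_mem τ hx) (mem_image_of_mem τ hy)
  simp only [Function.comp_apply, zero_mul, norm_le_zero_iff, sub_eq_zero] at h
  rwa [hτ.inj.leftInvOn_invFunOn hx, hτ.inj.leftInvOn_invFunOn hy] at h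

lemma exists_derivative_eq (q : ℝ[X]) (p : ℕ) (hq : q.degree < p) :
    ∃ Q : ℝ[X], derivative Q = q ∧ Q.degree < (p + 1 : ℕ) := by
  rcases eq_or_ne q 0 with rfl | h0
  · exact ⟨0, derivative_zero, by simp⟩
  refine ⟨∑ i ∈ Finset.range p, monomial (i + 1) (q.coeff i / (i + 1)), ?_, ?_⟩
  · rw [derivative_sum]
    conv_rhs => rw [q.as_sum_range_C_mul_X_pow' (n := p) ((natDegree_lt_iff_degree_lt h0).2 hq)]
    refine Finset.sum_congr rfl fun i _ => ?_
    have : (i + 1 : ℝ) ≠ 0 := by positivity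
    rw [derivative_monomial, C_mul_X_pow_eq_monomial, Nat.add_sub_cancel]
    push_cast
    rw [div_mul_cancel₀ _ this]
  · rw [degree_lt_iff_coeff_zero]
    intro m hm
    rw [finsetSum_coeff]
    refine Finset.sum_eq_zero fun i hi => ?_
    rw [Finset.mem_range] at hi
    rw [coeff_monomial, if_neg (by omega)]

/-- Two `p`-th antiderivatives of a function differ by a polynomial of degree less than `p`. -/
lemma exists_poly_of_genAntideriv (hτ : IsParam γ₁ γ₂ a b τ) (p : ℕ) {F G : ℝ → ℝ}
    (hF : GenDifferentiable γ₁ γ₂ a b p F) (hG : GenDifferentiable γ₁ γ₂ a b p G)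
    (h : EqOn ((genDeriv γ₁ γ₂ a b)^[p] G) ((genDeriv γ₁ γ₂ a b)^[p] F) (Icc a b)) :
    ∃ e : ℝ[X], e.degree < p ∧ ∀ x ∈ Icc a b, G x = F x + e.eval (τ x) := by
  induction p generalizing F G with
  | zero => exact ⟨0, by simp, fun x hx => by simpa using h hx⟩
  | succ p ih =>
    rw [genDifferentiable_succ_iff] at hF hG
    obtain ⟨q, hq, hqe⟩ := ih hF.2 hG.2 h
    obtain ⟨Q, hQ, hQd⟩ := exists_derivative_eq q p hq
    -- `E` is `G - F - Q(τ)`; its derivative vanishes, so it is the constant of integration.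
    set E : ℝ → ℝ := G + polyMul τ (-1) F + fun y => (-Q).eval (τ y) with hE
    have hE0 : ∀ x ∈ Icc a b, HasGenDerivAt γ₁ γ₂ a b E 0 x := by
      intro x hx
      have := ((hG.1.hasGenDerivAt hτ hx).add ((hF.1.hasGenDerivAt hτ hx).polyMul hτ (-1) hx)).add
        (polyFun_hasGenDerivAt hτ (-Q) hx)
      convert this using 1
      rw [hqe x hx]
      simp [hQ]
    have ha : a ∈ Icc a b := left_mem_Icc.2 hτ.lt.le
    refine ⟨Q + C (E a), (degree_add_le _ _).trans_lt (max_lt hQd ?_), fun x hx => ?_⟩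
    · exact degree_C_le.trans_lt (by exact_mod_cast Nat.succ_pos p)
    · have h := eq_of_hasGenDerivAt_zero hτ hE0 ha hx
      rw [eval_add, eval_C, ← h]
      simp [hE, polyMul]

/-- The first `p` derivatives come from `F` being an antiderivative, the others from `H`. -/
lemma IsGenAntideriv.genDifferentiable {F H : ℝ → ℝ} {p : ℕ} {r : ℕ∞}
    (hF : IsGenAntideriv γ₁ γ₂ a b p F H) (hH : GenDifferentiable γ₁ γ₂ a b r H) {m : ℕ}
    (hm : (m : ℕ∞) ≤ (p + 1 : ℕ) + r) : GenDifferentiable γ₁ γ₂ a b (m - 1 : ℕ) F := by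
  rcases le_or_gt (m - 1) p with h | h
  · exact hF.1.mono (by exact_mod_cast h)
  · obtain ⟨j, rfl⟩ := Nat.exists_eq_add_of_le (show p + 1 ≤ m by omega)
    rw [show p + 1 + j - 1 = p + j by omega, genDifferentiable_add_iff]
    refine ⟨hF.1, (hH.mono ?_).congr hF.2⟩
    push_cast at hm
    exact (ENat.add_le_add_iff_left (by norm_cast; exact ENat.natCast_ne_top _)).1 hm

/-- Hermite data may be arbitrary numbers, so no regularity of `F` is required here. -/
lemma exists_jetEq (hτ : IsParam γ₁ γ₂ a b τ) (F : ℝ → ℝ) {n : ℕ} {ε : Fin n → ℝ}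
    (hε : ∀ i, ε i ∈ Icc a b) :
    ∃ q : ℝ[X], ∀ i, JetEq γ₁ γ₂ a b τ F q (ε i) (mult ε (ε i)) := by
  obtain ⟨q, hq⟩ := exists_hermite
    (fun s j => (genDeriv γ₁ γ₂ a b)^[j] F (Function.invFunOn τ (Icc a b) s))
    (Finset.univ.val.map fun i => τ (ε i))
  refine ⟨q, fun i j hj => ?_⟩
  rw [hq (τ (ε i)) j (hj.trans_le ?_), hτ.inj.leftInvOn_invFunOn (hε i)]
  rw [Multiset.count_map]
  change (Finset.univ.filter fun j => ε j = ε i).card ≤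
    (Finset.univ.filter fun j => τ (ε i) = τ (ε j)).card
  refine Finset.card_le_card fun l hl => ?_
  simp only [Finset.mem_filter, Finset.mem_univ, true_and] at hl ⊢
  rw [hl]

lemma polyDivDiff_mul_pow_const (q : ℝ[X]) (t : ℝ) (p m : ℕ) :
    polyDivDiff (q * (X - C t) ^ m) (fun _ : Fin (p + 1 + m) => t) =
      (derivative^[p] q).eval t / p.factorial := by
  induction m with
  | zero => rw [pow_zero, mul_one]; exact polyDivDiff_const q p t
  | succ m ih =>
    have h : (fun _ : Fin (p + 1 + m + 1) => t) =
        (Fin.snoc (fun _ : Fin (p + 1 + m) => t) t : Fin (p + 1 + m + 1) → ℝ) := by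
      funext i
      refine Fin.lastCases ?_ (fun i => ?_) i <;> simp
    rw [← ih, pow_succ, ← mul_assoc]
    change polyDivDiff _ (fun _ : Fin (p + 1 + m + 1) => t) = _
    rw [h, polyDivDiff_snoc _ (by omega)]

/-! ### Linear forms and the choice of the parameter -/

/-- `ℓ Y` is the polynomial in `τ` of degree at most one that represents `Y.1 γ₂ - Y.2 γ₁`. -/
structure IsLinearForm (γ₁ γ₂ : ℝ → ℝ) (a b : ℝ) (τ : ℝ → ℝ) (ℓ : ℝ × ℝ → ℝ[X]) : Prop where
  map_add : ∀ (α β : ℝ) (Y Z : ℝ × ℝ), ℓ (α • Y + β • Z) = C α * ℓ Y + C β * ℓ Z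
  natDegree_le : ∀ Y, (ℓ Y).natDegree ≤ 1
  eval_eq : ∀ Y, ∀ x ∈ Icc a b, (ℓ Y).eval (τ x) = Y.1 * γ₂ x - Y.2 * γ₁ x
  curve_eq : ∀ t ∈ Icc a b, ℓ (curve γ₁ γ₂ t) = X - C (τ t)

lemma exists_param (hab : a < b) (hγ₁ : ContinuousOn γ₁ (Icc a b))
    (hγ₂ : ContinuousOn γ₂ (Icc a b))
    (hd : ∀ x ∈ Icc a b, ∀ y ∈ Icc a b, x ≠ y → dfun γ₁ γ₂ x y ≠ 0)
    (hone : ∃ c₁ c₂ : ℝ, ∀ x ∈ Icc a b, c₁ * γ₁ x + c₂ * γ₂ x = 1) :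
    ∃ τ ℓ, IsParam γ₁ γ₂ a b τ ∧ IsLinearForm γ₁ γ₂ a b τ ℓ := by
  obtain ⟨c₁, c₂, hc⟩ := hone
  have hne : c₁ ^ 2 + c₂ ^ 2 ≠ 0 := by
    intro h
    have h₁ : c₁ = 0 := by nlinarith [sq_nonneg c₁, sq_nonneg c₂]
    have h₂ : c₂ = 0 := by nlinarith [sq_nonneg c₁, sq_nonneg c₂]
    simpa [h₁, h₂] using hc a (left_mem_Icc.2 hab.le)
  obtain ⟨e₁, e₂, hdet⟩ : ∃ e₁ e₂ : ℝ, c₁ * e₂ - c₂ * e₁ = 1 :=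
    -- The vector `(c₁, c₂)` rotated by a right angle and scaled to determinant one; Cramer's rule
    -- then expresses `γ₁` and `γ₂` through `τ`.
    ⟨-c₂ / (c₁ ^ 2 + c₂ ^ 2), c₁ / (c₁ ^ 2 + c₂ ^ 2), by field_simp; ring⟩
  have hγ₁τ : ∀ x ∈ Icc a b, γ₁ x = e₂ - c₂ * (e₁ * γ₁ x + e₂ * γ₂ x) := fun x hx => by
    linear_combination (-γ₁ x) * hdet + e₂ * hc x hx
  have hγ₂τ : ∀ x ∈ Icc a b, γ₂ x = c₁ * (e₁ * γ₁ x + e₂ * γ₂ x) - e₁ := fun x hx => by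
    linear_combination (-γ₂ x) * hdet - e₁ * hc x hx
  have hdτ : ∀ x ∈ Icc a b, ∀ y ∈ Icc a b, dfun γ₁ γ₂ x y =
      (e₁ * γ₁ y + e₂ * γ₂ y) - (e₁ * γ₁ x + e₂ * γ₂ x) := fun x hx y hy => by
    unfold dfun
    linear_combination (-(γ₁ x * γ₂ y - γ₁ y * γ₂ x)) * hdet +
      (e₁ * γ₁ y + e₂ * γ₂ y) * hc x hx - (e₁ * γ₁ x + e₂ * γ₂ x) * hc y hy
  refine ⟨fun x => e₁ * γ₁ x + e₂ * γ₂ x,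
    fun Y => C Y.1 * (C c₁ * X - C e₁) - C Y.2 * (C e₂ - C c₂ * X),
    ⟨hab, by fun_prop, fun x hx y hy hxy => ?_, hdτ⟩, ⟨fun α β Y Z => ?_, fun Y => ?_,
    fun Y x hx => ?_, fun t ht => ?_⟩⟩
  · by_contra hne
    exact hd x hx y hy hne (by rw [hdτ x hx y hy]; exact sub_eq_zero.2 hxy.symm)
  · simp only [Prod.fst_add, Prod.snd_add, Prod.smul_fst, Prod.smul_snd, smul_eq_mul, C_add, C_mul]
    ring
  · compute_degree
  · simp only [eval_sub, eval_mul, eval_C, eval_X]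
    rw [← hγ₁τ x hx, ← hγ₂τ x hx]
  · have h₁ : (C (γ₁ t * c₁ + γ₂ t * c₂) : ℝ[X]) = 1 := by
      rw [← C_1, ← hc t ht]
      ring_nf
    simp only [curve, C_add, C_mul] at h₁ ⊢
    linear_combination X * h₁

lemma divDiff_eq_of_jetEq (hτ : IsParam γ₁ γ₂ a b τ) {ℓ : ℝ × ℝ → ℝ[X]}
    (hℓ : IsLinearForm γ₁ γ₂ a b τ ℓ) {F : ℝ → ℝ} {q : ℝ[X]} {m n : ℕ} {ε : Fin n → ℝ}
    (hε : ∀ i, ε i ∈ Icc a b) (hF : ∀ i, JetEq γ₁ γ₂ a b τ F q (ε i) (mult ε (ε i)))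
    (hFd : ∀ i, GenDifferentiable γ₁ γ₂ a b (mult ε (ε i) - 1 : ℕ) F) (c : ℝ)
    (Y : Fin m → ℝ × ℝ) :
    divDiff γ₁ γ₂ a b (fun x => c * (∏ i, ((Y i).1 * γ₂ x - (Y i).2 * γ₁ x)) * F x) n ε =
      polyDivDiff (C c * (∏ i, ℓ (Y i)) * q) (fun i => τ (ε i)) := by
  refine divDiff_eq_polyDivDiff hτ hε fun i =>
    ((hF i).polyMul hτ (C c * ∏ i, ℓ (Y i)) (hε i) (hFd i)).congr (hε i) fun x hx => ?_
  simp only [polyMul, eval_mul, eval_C, eval_prod]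
  rw [Finset.prod_congr rfl fun i _ => hℓ.eval_eq (Y i) x hx]

lemma polyDivDiff_prod_eq_zero {ℓ : ℝ × ℝ → ℝ[X]} (hℓ : IsLinearForm γ₁ γ₂ a b τ ℓ) {e : ℝ[X]}
    {p m : ℕ} (he : e.degree < p) (c : ℝ) (Y : Fin m → ℝ × ℝ) (s : Fin (p + 1 + m) → ℝ) :
    polyDivDiff (C c * (∏ i, ℓ (Y i)) * e) s = 0 := by
  rcases eq_or_ne e 0 with rfl | h0
  · simp [polyDivDiff]
  have hp : e.natDegree < p := (natDegree_lt_iff_degree_lt h0).2 he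
  have h1 : (∏ i, ℓ (Y i)).natDegree ≤ m := by
    refine (natDegree_prod_le _ _).trans
      ((Finset.sum_le_sum fun i _ => hℓ.natDegree_le (Y i)).trans ?_)
    simp
  have h2 : (C c * (∏ i, ℓ (Y i)) * e).natDegree < p + m := by
    have h3 := natDegree_mul_le (p := C c * ∏ i, ℓ (Y i)) (q := e)
    have h4 := natDegree_C_mul_le c (∏ i, ℓ (Y i))
    omega
  rw [polyDivDiff_eq_coeff]
  · exact coeff_eq_zero_of_natDegree_lt (by omega)
  · exact degree_le_natDegree.trans_lt (by norm_cast; omega)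

/-! ### Admissible parameters and the blossom axioms -/

lemma Admissible.of_snoc {N : ℕ∞} {n : ℕ} {U : Fin n → ℝ × ℝ} {Y : ℝ × ℝ}
    (h : Admissible γ₁ γ₂ a b N (Fin.snoc U Y : Fin (n + 1) → ℝ × ℝ)) :
    Admissible γ₁ γ₂ a b N U := by
  refine ⟨fun j => by simpa using h.1 j.castSucc, fun Q => le_trans ?_ (h.2 Q)⟩
  rw [← (Fin.castSucc_injective n).injOn.encard_image]
  refine encard_le_encard ?_
  rintro _ ⟨j, hj, rfl⟩
  simpa using hj

lemma Admissible.mult_le {N : ℕ∞} {n : ℕ} {U : Fin n → ℝ × ℝ}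
    (h : Admissible γ₁ γ₂ a b N U) {ε : Fin n → ℝ} (hε : ∀ j, curve γ₁ γ₂ (ε j) = U j) (t : ℝ) :
    (mult ε t : ℕ∞) ≤ N := by
  refine le_trans ?_ (h.2 (curve γ₁ γ₂ t))
  rw [mult, ← encard_coe_eq_coe_finsetCard]
  refine encard_le_encard fun j hj => ?_
  simp only [Finset.coe_filter, Finset.mem_univ, true_and, mem_ofPred_eq] at hj ⊢
  rw [← hε, hj]

lemma IsParam.curve_injOn (hτ : IsParam γ₁ γ₂ a b τ) : InjOn (curve γ₁ γ₂) (Icc a b) := by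
  intro x hx y hy h
  simp only [curve, Prod.mk.injEq] at h
  refine hτ.inj hx hy (sub_eq_zero.1 ?_).symm
  rw [← hτ.dfun_eq x hx y hy, dfun, h.1, h.2]
  ring

lemma mult_perm {n : ℕ} (ε : Fin n → ℝ) (σ : Equiv.Perm (Fin n)) (t : ℝ) :
    mult (fun j => ε (σ j)) t = mult ε t := by
  refine (mult_comp_le ε σ.injective t).antisymm ?_
  simpa using mult_comp_le (fun j => ε (σ j)) σ.symm.injective t

/-- The node `t` of the parameter `Q = P(t)`. -/
def node (γ₁ γ₂ : ℝ → ℝ) (a b : ℝ) : ℝ × ℝ → ℝ := Function.invFunOn (curve γ₁ γ₂) (Icc a b)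

/-- The blossom defined by the divided differences of a `p`-th antiderivative `F`. -/
def blossom (γ₁ γ₂ : ℝ → ℝ) (a b : ℝ) (p : ℕ) (F : ℝ → ℝ) (m n : ℕ) (Y : Fin m → ℝ × ℝ)
    (U : Fin n → ℝ × ℝ) : ℝ :=
  divDiff γ₁ γ₂ a b
    (fun x => (p.factorial : ℝ) * (∏ i, ((Y i).1 * γ₂ x - (Y i).2 * γ₁ x)) * F x) n
    fun j => node γ₁ γ₂ a b (U j)

section

variable {ℓ : ℝ × ℝ → ℝ[X]} {p : ℕ} {r : ℕ∞} {F H : ℝ → ℝ}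

lemma Admissible.node_mem {N : ℕ∞} {n : ℕ} {U : Fin n → ℝ × ℝ}
    (h : Admissible γ₁ γ₂ a b N U) (j : Fin n) : node γ₁ γ₂ a b (U j) ∈ Icc a b :=
  Function.invFunOn_mem (h.1 j)

lemma Admissible.curve_node {N : ℕ∞} {n : ℕ} {U : Fin n → ℝ × ℝ}
    (h : Admissible γ₁ γ₂ a b N U) (j : Fin n) : curve γ₁ γ₂ (node γ₁ γ₂ a b (U j)) = U j :=
  Function.invFunOn_eq (h.1 j)

lemma blossom_eq (hτ : IsParam γ₁ γ₂ a b τ) (hℓ : IsLinearForm γ₁ γ₂ a b τ ℓ)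
    (hH : GenDifferentiable γ₁ γ₂ a b r H) (hF : IsGenAntideriv γ₁ γ₂ a b p F H) {m n : ℕ}
    {U : Fin n → ℝ × ℝ} (hU : Admissible γ₁ γ₂ a b ((p + 1 : ℕ) + r) U) {q : ℝ[X]}
    (hq : ∀ i, JetEq γ₁ γ₂ a b τ F q (node γ₁ γ₂ a b (U i))
      (mult (fun j => node γ₁ γ₂ a b (U j)) (node γ₁ γ₂ a b (U i)))) (Y : Fin m → ℝ × ℝ) :
    blossom γ₁ γ₂ a b p F m n Y U = polyDivDiff (C (p.factorial : ℝ) * (∏ i, ℓ (Y i)) * q)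
      fun j => τ (node γ₁ γ₂ a b (U j)) :=
  divDiff_eq_of_jetEq hτ hℓ hU.node_mem hq
    (fun _ => hF.genDifferentiable hH (hU.mult_le hU.curve_node _)) _ _

lemma Admissible.perm {N : ℕ∞} {n : ℕ} {U : Fin n → ℝ × ℝ} (h : Admissible γ₁ γ₂ a b N U)
    (σ : Equiv.Perm (Fin n)) : Admissible γ₁ γ₂ a b N (U ∘ σ) := by
  refine ⟨fun j => h.1 _, fun Q => le_trans (le_of_eq ?_) (h.2 Q)⟩
  rw [← σ.injective.injOn.encard_image]
  congr 1
  ext j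
  simp [Equiv.image_eq_preimage_symm]

lemma isExtendedBlossom_blossom (hτ : IsParam γ₁ γ₂ a b τ) (hℓ : IsLinearForm γ₁ γ₂ a b τ ℓ)
    (hH : GenDifferentiable γ₁ γ₂ a b r H) (hF : IsGenAntideriv γ₁ γ₂ a b p F H) {k : ℤ}
    (hk : k = -(p + 1 : ℕ)) :
    IsExtendedBlossom γ₁ γ₂ a b k ((p + 1 : ℕ) + r) H (blossom γ₁ γ₂ a b p F) where
  bisymmetry m n _ Y U hU σ π := by
    obtain ⟨q, hq⟩ := exists_jetEq hτ F hU.node_mem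
    rw [blossom_eq hτ hℓ hH hF hU hq, blossom_eq hτ hℓ hH hF (hU.perm π) (q := q)]
    · simp only [Function.comp_apply]
      rw [Equiv.prod_comp σ fun i => ℓ (Y i)]
      exact polyDivDiff_perm _ (fun j => τ (node γ₁ γ₂ a b (U j))) π
    · intro i
      have := hq (π i)
      rwa [← mult_perm _ π] at this
  multilinearity m n _ Y U hU i α β Z W := by
    obtain ⟨q, hq⟩ := exists_jetEq hτ F hU.node_mem
    simp only [blossom_eq hτ hℓ hH hF hU hq]
    rw [← polyDivDiff_linear]
    congr 1
    have h : ∀ Z, ∏ j, ℓ (Function.update Y i Z j) = ℓ Z * ∏ j ∈ Finset.univ.erase i, ℓ (Y j) := by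
      intro Z
      rw [← Finset.mul_prod_erase _ _ (Finset.mem_univ i), Function.update_self]
      congr 1
      refine Finset.prod_congr rfl fun j hj => ?_
      rw [Function.update_of_ne (Finset.ne_of_mem_erase hj)]
    rw [h, h, h, hℓ.map_add]
    ring
  cancellation m n hmn Y U Z hU := by
    obtain ⟨q, hq⟩ := exists_jetEq hτ F hU.node_mem
    -- The interpolant for the longer tuple also serves the shorter one, whose multiplicities are no
    -- larger.
    have hsub : ∀ i, JetEq γ₁ γ₂ a b τ F q (node γ₁ γ₂ a b (U i))
        (mult (fun j => node γ₁ γ₂ a b (U j)) (node γ₁ γ₂ a b (U i))) := by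
      intro i
      have h₁ := hq i.castSucc
      have h₂ := mult_comp_le
        (fun j => node γ₁ γ₂ a b ((Fin.snoc U Z : Fin (n + 1) → ℝ × ℝ) j))
        (Fin.castSucc_injective n) (node γ₁ γ₂ a b (U i))
      simp only [Fin.snoc_castSucc] at h₁ h₂
      exact h₁.mono h₂
    rw [blossom_eq hτ hℓ hH hF hU hq, blossom_eq hτ hℓ hH hF hU.of_snoc hsub]
    have hZ : ℓ Z = X - C (τ (node γ₁ γ₂ a b Z)) := by
      have h₁ := hU.node_mem (Fin.last n)
      have h₂ := hU.curve_node (Fin.last n)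
      rw [Fin.snoc_last] at h₁ h₂
      rw [← hℓ.curve_eq _ h₁, h₂]
    have hs : (fun j => τ (node γ₁ γ₂ a b ((Fin.snoc U Z : Fin (n + 1) → ℝ × ℝ) j))) =
        (Fin.snoc (fun j => τ (node γ₁ γ₂ a b (U j))) (τ (node γ₁ γ₂ a b Z)) :
          Fin (n + 1) → ℝ) := by
      funext i
      refine Fin.lastCases ?_ (fun i => ?_) i <;> simp
    rw [Fin.prod_univ_castSucc, hs]
    simp only [Fin.snoc_castSucc, Fin.snoc_last]
    rw [hZ, show ∀ A B D E : ℝ[X], A * (B * D) * E = A * B * E * D by intros; ring]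
    exact polyDivDiff_snoc _ (by omega) _ _
  diagonal m n hmn t ht hU := by
    obtain rfl : n = p + 1 + m := by omega
    obtain ⟨q, hq⟩ := exists_jetEq hτ F hU.node_mem
    have hnode : node γ₁ γ₂ a b (curve γ₁ γ₂ t) = t := hτ.curve_injOn.leftInvOn_invFunOn ht
    rw [blossom_eq hτ hℓ hH hF hU hq]
    simp only [hnode] at hq ⊢
    -- The product is `(X - τ t)^m`; it cancels `m` of the `p + 1 + m` nodes.
    rw [hℓ.curve_eq t ht, Finset.prod_const, Finset.card_univ, Fintype.card_fin, mul_right_comm,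
      polyDivDiff_mul_pow_const, iterate_derivative_C_mul, eval_mul, eval_C,
      ← hq ⟨0, by omega⟩ p (by simp [mult]; omega), hF.2 t ht]
    field_simp

end

end NonpolyBlossom

end

/-! ### The theorem -/

theorem mainTheorem3 (γ₁ γ₂ : ℝ → ℝ) (a b : ℝ) (hab : a < b)
    (hγ₁ : ContinuousOn γ₁ (Set.Icc a b)) (hγ₂ : ContinuousOn γ₂ (Set.Icc a b))
    (hd : ∀ x ∈ Set.Icc a b, ∀ y ∈ Set.Icc a b, x ≠ y → NonpolyBlossom.dfun γ₁ γ₂ x y ≠ 0)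
    (hone : ∃ c₁ c₂ : ℝ, ∀ x ∈ Set.Icc a b, c₁ * γ₁ x + c₂ * γ₂ x = 1)
    (H : ℝ → ℝ) (hHc : ContinuousOn H (Set.Icc a b))
    (r : ℕ∞) (hH : NonpolyBlossom.GenDifferentiable γ₁ γ₂ a b r H)
    (k : ℤ) (hk : k < 0) :
    ∃ h : (m n : ℕ) → (Fin m → ℝ × ℝ) → (Fin n → ℝ × ℝ) → ℝ,
      NonpolyBlossom.IsExtendedBlossom γ₁ γ₂ a b k ((-k).toNat + r) H h ∧
      ∀ m n : ℕ, (m : ℤ) - n = k →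
        (∃ F, NonpolyBlossom.IsGenAntideriv γ₁ γ₂ a b (n - m - 1) F H) ∧
        ∀ F, NonpolyBlossom.IsGenAntideriv γ₁ γ₂ a b (n - m - 1) F H →
          ∀ (X : Fin m → ℝ × ℝ) (U : Fin n → ℝ × ℝ) (ε : Fin n → ℝ),
            NonpolyBlossom.Admissible γ₁ γ₂ a b ((-k).toNat + r) U →
            (∀ j, ε j ∈ Set.Icc a b) → (∀ j, U j = (γ₁ (ε j), γ₂ (ε j))) →
            h m n X U =
              NonpolyBlossom.divDiff γ₁ γ₂ a b
                (fun x => (Nat.factorial (n - m - 1) : ℝ) *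
                  (∏ i, ((X i).1 * γ₂ x - (X i).2 * γ₁ x)) * F x) n ε := by
  open NonpolyBlossom in
  obtain ⟨τ, ℓ, hτ, hℓ⟩ := exists_param hab hγ₁ hγ₂ hd hone
  obtain ⟨p, rfl⟩ : ∃ p : ℕ, k = -(p + 1 : ℕ) := ⟨(-k).toNat - 1, by omega⟩
  rw [show (- -((p + 1 : ℕ) : ℤ)).toNat = p + 1 by omega]
  obtain ⟨F₀, -, hF₀⟩ := exists_genAntideriv hτ hHc p
  refine ⟨blossom γ₁ γ₂ a b p F₀, isExtendedBlossom_blossom hτ hℓ hH hF₀ rfl, fun m n hmn => ?_⟩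
  obtain rfl : n = p + 1 + m := by omega
  rw [show p + 1 + m - m - 1 = p by omega]
  refine ⟨⟨F₀, hF₀⟩, fun F hF Y U ε hU hε hUε => ?_⟩
  obtain ⟨e, he, hFe⟩ := exists_poly_of_genAntideriv hτ p hF₀.1 hF.1
    fun x hx => (hF.2 x hx).trans (hF₀.2 x hx).symm
  obtain rfl : U = fun j => curve γ₁ γ₂ (ε j) := funext hUε
  have hnode : ∀ j, node γ₁ γ₂ a b (curve γ₁ γ₂ (ε j)) = ε j := fun j =>
    hτ.curve_injOn.leftInvOn_invFunOn (hε j)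
  obtain ⟨q, hq⟩ := exists_jetEq hτ F₀ hε
  have hdiff : ∀ G, IsGenAntideriv γ₁ γ₂ a b p G H → ∀ i,
      GenDifferentiable γ₁ γ₂ a b (mult ε (ε i) - 1 : ℕ) G := fun G hG i =>
    hG.genDifferentiable hH (hU.mult_le (fun _ => rfl) _)
  -- On `[a, b]`, `F = F₀ + e(τ)`, so `q + e` interpolates `F`; the contribution of `e` is then
  -- killed by its degree.
  have hq' : ∀ i, JetEq γ₁ γ₂ a b τ F (q + e) (ε i) (mult ε (ε i)) := fun i =>
    ((hq i).add hτ (hε i) (polyFun_jetEq hτ e (hε i) _) (hdiff F₀ hF₀ i)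
      (polyFun_genDifferentiable hτ e _)).congr (hε i) hFe
  rw [divDiff_eq_of_jetEq hτ hℓ hε hq' (hdiff F hF),
    blossom_eq hτ hℓ hH hF₀ hU (q := q) (by simpa only [hnode] using hq), mul_add]
  have h := polyDivDiff_linear 1 1 (Polynomial.C (p.factorial : ℝ) * (∏ i, ℓ (Y i)) * q)
    (Polynomial.C (p.factorial : ℝ) * (∏ i, ℓ (Y i)) * e) fun i => τ (ε i)
  rw [polyDivDiff_prod_eq_zero hℓ he] at h
  simp only [Polynomial.C_1, one_mul, mul_zero, add_zero] at h
  simp only [hnode, h]
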